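/- Let $d\in\mathbb N$, $p\in(1,\infty)$ and $t\ge 0$. Let $\mathcal M_p$ be the set $\mathcal P_p(\mathbb R^d)$ of Borel probability measures on $\mathbb R^d$ with finite $p$-th moment, endowed with the Wasserstein metric $$W_p(\mu,\nu)=\inf_{\pi}\Big(\iint|x-y|^p\,d\pi(x,y)\Big)^{1/p},$$ the infimum being over all couplings $\pi$ of $\mu$ and $\nu$. Let $AC_p([0,t],\mathcal M_p)$ be the set of paths $\sigma:[0,t]\to\mathcal M_p$ for which there is $h\in L^p([0,t])$ with $W_p(\sigma(s_1),\sigma(s_2))\le\int_{s_1}^{s_2}h(u)\,du$ for all $0\le s_1\le s_2\le t$; the (almost everywhere) smallest such $h$ is the metric derivative $\|\dot\sigma\|$ of $\sigma$. Let $d_{LP}$ be the Lévy–Prokhorov metric, $$d_{LP}(\mu,\nu)=\inf\{\epsilon>0:\ \mu(A)\le\nu(A^\epsilon)+\epsilon,\ \nu(A)\le\mu(A^\epsilon)+\epsilon\ \text{ for all Borel } A\subset\mathbb R^d\},\qquad A^\epsilon=\bigcup_{z\in A}B_\epsilon(z).$$ **Proposition 4.1.** Let $\mu\in\mathcal M_p$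 and let $(\sigma^k)_{k\in\mathbb N}\subset AC_p([0,t],\mathcal M_p)$ be a sequence such that $\sigma^k(t)=\mu$ for all $k\in\mathbb N$ and $$\sup_{k\in\mathbb N}\int_0^t\|\dot\sigma^k(s)\|^p\,ds<\infty.$$ Then there are a subsequence $(\sigma^{k_j})_{j\in\mathbb N}$ and $\eta\in AC_p([0,t],\mathcal M_p)$ such that $\sigma^{k_j}\to\eta$ in $C([0,t],(\mathcal P_p(\mathbb R^d),d_{LP}))$ as $j\to\infty$, that is, all these paths are $d_{LP}$-continuous and $\sup_{s\in[0,t]}d_{LP}(\sigma^{k_j}(s),\eta(s))\to0$. Moreover, $\eta$ has a metric derivative and $$\int_0^t\|\dot\eta(s)\|^p\,ds\le\liminf_{j\to\infty}\int_0^t\|\dot\sigma^{k_j}(s)\|^p\,ds.$$ -/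

import Mathlib

open MeasureTheory Filter Set
open scoped ENNReal Topology

noncomputable section

namespace WassersteinCurves

/-- The Euclidean space `ℝ^d`. -/
abbrev Space (d : ℕ) : Type := EuclideanSpace ℝ (Fin d)

/-- The underlying set of the `p`-Wasserstein space: the Borel probability measures on `ℝ^d` with
finite `p`-th moment. -/
def ProbWithMoment (d : ℕ) (p : ℝ) : Type :=
  {μ : ProbabilityMeasure (Space d) // ∫⁻ x, ‖x‖ₑ ^ p ∂(μ : Measure (Space d)) < ∞}

/-- The underlying measure of an element of the `p`-Wasserstein space. -/
def ProbWithMoment.meas {d : ℕ} {p : ℝ} (μ : ProbWithMoment d p) : Measure (Space d) :=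
  ((μ.1 : ProbabilityMeasure (Space d)) : Measure (Space d))

/-- The couplings of two measures on `ℝ^d`: the probability measures on `ℝ^d × ℝ^d` with the given
first and second marginal. If both marginals have finite `p`-th moment, then so has every
coupling. -/
def couplings {d : ℕ} (μ ν : Measure (Space d)) : Set (Measure (Space d × Space d)) :=
  {π | IsProbabilityMeasure π ∧ π.map Prod.fst = μ ∧ π.map Prod.snd = ν}

/-- The `p`-Wasserstein distance, with values in `[0, ∞]`: the infimum over all couplings of
`(∬ |x - y|^p dπ(x, y))^(1/p)`. -/
def wassersteinEDist {d : ℕ} (p : ℝ) (μ ν : Measure (Space d)) : ℝ≥0∞ :=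
  ⨅ π ∈ couplings μ ν, (∫⁻ z, ‖z.1 - z.2‖ₑ ^ p ∂π) ^ (1 / p)

/-- The `p`-Wasserstein distance is finite between measures with finite `p`-th moment. -/
theorem wassersteinEDist_ne_top {d : ℕ} {p : ℝ} (hp : 1 ≤ p) (μ ν : ProbWithMoment d p) :
    wassersteinEDist p μ.meas ν.meas ≠ ∞ := by
  have hμ : IsProbabilityMeasure μ.meas := μ.1.2
  have hν : IsProbabilityMeasure ν.meas := ν.1.2
  have h0 : (0 : ℝ) ≤ p := by linarith
  have hc : μ.meas.prod ν.meas ∈ couplings μ.meas ν.meas :=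
    ⟨inferInstance, by simp [Measure.map_fst_prod], by simp [Measure.map_snd_prod]⟩
  have hmeas : Measurable fun x : Space d => ‖x‖ₑ ^ p := by fun_prop
  have h1 : ∫⁻ z : Space d × Space d, ‖z.1‖ₑ ^ p ∂(μ.meas.prod ν.meas) < ∞ := by
    rw [lintegral_prod _ (by fun_prop)]
    simpa [ProbWithMoment.meas] using μ.2
  have h2 : ∫⁻ z : Space d × Space d, ‖z.2‖ₑ ^ p ∂(μ.meas.prod ν.meas) < ∞ := by
    rw [lintegral_prod _ (by fun_prop)]
    simpa [ProbWithMoment.meas] using ν.2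
  have h3 : ∫⁻ z : Space d × Space d, ‖z.1 - z.2‖ₑ ^ p ∂(μ.meas.prod ν.meas) < ∞ := by
    have hle : ∀ z : Space d × Space d,
        ‖z.1 - z.2‖ₑ ^ p ≤ (2 : ℝ≥0∞) ^ (p - 1) * (‖z.1‖ₑ ^ p + ‖z.2‖ₑ ^ p) := fun z =>
      (ENNReal.rpow_le_rpow (enorm_sub_le) h0).trans
        (ENNReal.rpow_add_le_mul_rpow_add_rpow _ _ hp)
    refine (lintegral_mono hle).trans_lt ?_
    rw [lintegral_const_mul _ (by fun_prop), lintegral_add_left (by fun_prop)]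
    exact ENNReal.mul_lt_top (ENNReal.rpow_lt_top_of_nonneg (by linarith) (by simp))
      (ENNReal.add_lt_top.2 ⟨h1, h2⟩)
  refine ne_top_of_le_ne_top ?_ (iInf₂_le _ hc)
  exact ENNReal.rpow_ne_top_of_nonneg (by positivity) h3.ne

/-- The `p`-Wasserstein metric `W_p` on the measures with finite `p`-th moment. -/
def wassersteinDist {d : ℕ} {p : ℝ} (μ ν : ProbWithMoment d p) : ℝ :=
  (wassersteinEDist p μ.meas ν.meas).toReal

/-- `h ∈ L^p([0,t])` and `W_p(σ(s₁), σ(s₂)) ≤ ∫_{s₁}^{s₂} h` for all `0 ≤ s₁ ≤ s₂ ≤ t`.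
A path on `[0,t]` is represented by a function on `ℝ` of which only the values on `[0,t]` are
used. -/
def IsSpeedBound {d : ℕ} {p : ℝ} (t : ℝ) (σ : ℝ → ProbWithMoment d p) (h : ℝ → ℝ) : Prop :=
  MemLp h (ENNReal.ofReal p) (volume.restrict (Icc 0 t)) ∧
    ∀ s₁ s₂ : ℝ, 0 ≤ s₁ → s₁ ≤ s₂ → s₂ ≤ t →
      wassersteinDist (σ s₁) (σ s₂) ≤ ∫ u in s₁..s₂, h u

/-- The class `AC_p([0,t], 𝓜_p)`. -/
def ACp (d : ℕ) (p t : ℝ) : Set (ℝ → ProbWithMoment d p) :=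
  {σ | ∃ h, IsSpeedBound t σ h}

/-- `m` is the metric derivative of `σ`: the smallest (almost everywhere on `[0,t]`) of the
functions `h ∈ L^p([0,t])` with `W_p(σ(s₁), σ(s₂)) ≤ ∫_{s₁}^{s₂} h`. It is unique up to
equality almost everywhere. -/
def IsMetricDerivative {d : ℕ} {p : ℝ} (t : ℝ) (σ : ℝ → ProbWithMoment d p) (m : ℝ → ℝ) : Prop :=
  IsSpeedBound t σ m ∧ ∀ h, IsSpeedBound t σ h → m ≤ᵐ[volume.restrict (Icc 0 t)] h

open scoped Classical in
/-- The metric derivative `s ↦ ‖σ̇(s)‖` of a path on `[0,t]` (a representative of its class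
modulo equality almost everywhere; every path in `AC_p([0,t], 𝓜_p)` has one). -/
def metricDerivative {d : ℕ} {p : ℝ} (t : ℝ) (σ : ℝ → ProbWithMoment d p) : ℝ → ℝ :=
  if hm : ∃ m, IsMetricDerivative t σ m then hm.choose else 0

/-- The `p`-action `∫_0^t ‖σ̇(s)‖^p ds`. -/
def pAction {d : ℕ} {p : ℝ} (t : ℝ) (σ : ℝ → ProbWithMoment d p) : ℝ :=
  ∫ s in (0 : ℝ)..t, metricDerivative t σ s ^ p

/-- A measure with finite `p`-th moment as a point of the space of all Borel probability measures
with the Lévy–Prokhorov metric. -/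
def toLP {d : ℕ} {p : ℝ} (μ : ProbWithMoment d p) : LevyProkhorov (ProbabilityMeasure (Space d)) :=
  LevyProkhorov.ofMeasure μ.1

/-- Convergence in `C([0,t], (𝓟_p(ℝ^d), d))`, where `d` is the Lévy–Prokhorov metric: all the paths
are continuous on `[0,t]`, and the convergence is uniform on `[0,t]`. -/
def ConvergesNarrowlyUniformly {d : ℕ} {p : ℝ} (t : ℝ) (σ : ℕ → ℝ → ProbWithMoment d p)
    (η : ℝ → ProbWithMoment d p) : Prop :=
  (∀ j, ContinuousOn (fun s => toLP (σ j s)) (Icc 0 t)) ∧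
    ContinuousOn (fun s => toLP (η s)) (Icc 0 t) ∧
    TendstoUniformlyOn (fun j s => toLP (σ j s)) (fun s => toLP (η s)) atTop (Icc 0 t)

end WassersteinCurves

end

noncomputable section

namespace WassersteinCurves

/-! Bounded action gives compactness through Hölder's inequality: a speed bound `h` with `∫ h ^ p ≤
M` yields `W_p(σ(a), σ(b)) ≤ M^(1/p) |b - a|^(1 - 1/p)` (`edist_le_rpow_mul`). With the common
endpoint this bounds all `p`-th moments, and measures with bounded moments are tight, hence form a
narrowly compact set (`isCompact_setOf_moment_le`). By Markov's inequality `W_p` controls the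
Lévy–Prokhorov metric uniformly, so the paths are equicontinuous there and Arzelà–Ascoli provides
the limit `η` (`exists_subseq_tendstoUniformlyOn`).

The convergence is only narrow, so what passes to `η` is the inequality `W_p(η(a), η(b)) ≤ liminf
W_p(σ_k(a), σ_k(b))`, by compactness of the almost optimal couplings (`wassersteinEDist_le_liminf`).
Summed over disjoint intervals, it makes `η` absolutely continuous; applied to difference quotients
and combined with Fatou, it bounds `∫ lowerSpeed η ^ p` by the liminf of the actions
(`lintegral_lowerSpeed_rpow_le_liminf`).

The lower speed is the metric derivative (`isMetricDerivative_lowerSpeed`): it bounds distances by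
the fundamental theorem of calculus for `s ↦ dist (ρ a) (ρ s)`, and it lies below every other speed
bound by Lebesgue differentiation. -/

open ProbabilityTheory in
/-- The gluing lemma: two couplings with a common middle marginal are marginals of a measure on the
triple product. -/
theorem exists_gluing {X Y Z : Type*} [MeasurableSpace X] [MeasurableSpace Y] [MeasurableSpace Z]
    [StandardBorelSpace Z] [Nonempty Z] (π₁ : Measure (X × Y)) (π₂ : Measure (Y × Z))
    [IsProbabilityMeasure π₁] [IsProbabilityMeasure π₂]
    (h : π₁.map Prod.snd = π₂.map Prod.fst) :
    ∃ γ : Measure ((X × Y) × Z), IsProbabilityMeasure γ ∧ γ.map Prod.fst = π₁ ∧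
      γ.map (fun w => (w.1.2, w.2)) = π₂ := by
  -- Given `(x, y)`, the third coordinate is drawn from the conditional law of `π₂` given `y`.
  let κ : Kernel (X × Y) Z := π₂.condKernel.comap Prod.snd measurable_snd
  refine ⟨π₁ ⊗ₘ κ, inferInstance, Measure.fst_compProd π₁ κ, ?_⟩
  have hdis : (π₁.map Prod.snd) ⊗ₘ π₂.condKernel = π₂ := by
    rw [h]; exact π₂.disintegrate π₂.condKernel
  have : IsProbabilityMeasure (π₁.map Prod.snd) :=
    Measure.isProbabilityMeasure_map measurable_snd.aemeasurable
  conv_rhs => rw [← hdis]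
  refine Measure.ext_of_lintegral _ fun f hf => ?_
  have hm : Measurable fun w : (X × Y) × Z => (w.1.2, w.2) := by fun_prop
  rw [lintegral_map hf hm, Measure.lintegral_compProd (by fun_prop),
    Measure.lintegral_compProd hf, lintegral_map _ measurable_snd]
  · simp [κ, Kernel.comap_apply]
  · exact Measurable.lintegral_kernel_prod_right' hf

/-! ### The Wasserstein distance and its comparison with the Lévy–Prokhorov distance. -/

section Wasserstein

variable {d : ℕ} {p : ℝ}

theorem measurable_enorm_sub_rpow :
    Measurable fun z : Space d × Space d => ‖z.1 - z.2‖ₑ ^ p := by fun_prop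

theorem wassersteinEDist_self (hp : 0 < p) (μ : Measure (Space d)) [IsProbabilityMeasure μ] :
    wassersteinEDist p μ μ = 0 := by
  have hm : Measurable fun x : Space d => (x, x) := by fun_prop
  have hc : μ.map (fun x => (x, x)) ∈ couplings μ μ := by
    refine ⟨Measure.isProbabilityMeasure_map hm.aemeasurable, ?_, ?_⟩
    · rw [Measure.map_map measurable_fst hm]; exact Measure.map_id
    · rw [Measure.map_map measurable_snd hm]; exact Measure.map_id
  refine le_antisymm ((iInf₂_le _ hc).trans ?_) zero_le
  rw [lintegral_map measurable_enorm_sub_rpow hm]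
  simp [hp]

theorem wassersteinEDist_comm_le (μ ν : Measure (Space d)) :
    wassersteinEDist p μ ν ≤ wassersteinEDist p ν μ := by
  refine le_iInf₂ fun π hπ => ?_
  obtain ⟨h1, h2, h3⟩ := hπ
  have hc : π.map Prod.swap ∈ couplings μ ν := by
    refine ⟨Measure.isProbabilityMeasure_map measurable_swap.aemeasurable, ?_, ?_⟩
    · rw [Measure.map_map measurable_fst measurable_swap, ← h3]; rfl
    · rw [Measure.map_map measurable_snd measurable_swap, ← h2]; rfl
  refine (iInf₂_le _ hc).trans (le_of_eq ?_)
  rw [lintegral_map measurable_enorm_sub_rpow measurable_swap]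
  congr 2
  funext z
  rw [← enorm_neg]; simp

theorem wassersteinEDist_comm (μ ν : Measure (Space d)) :
    wassersteinEDist p μ ν = wassersteinEDist p ν μ :=
  le_antisymm (wassersteinEDist_comm_le μ ν) (wassersteinEDist_comm_le ν μ)

/-- Gluing puts both couplings on one space, where Minkowski's inequality in `L^p` applies. -/
theorem wassersteinEDist_triangle (hp : 1 ≤ p) (μ ν ρ : Measure (Space d)) :
    wassersteinEDist p μ ρ ≤ wassersteinEDist p μ ν + wassersteinEDist p ν ρ := by
  refine ENNReal.le_iInf₂_add_iInf₂ fun π₁ h₁ π₂ h₂ => ?_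
  obtain ⟨i₁, a₁, b₁⟩ := h₁
  obtain ⟨i₂, a₂, b₂⟩ := h₂
  obtain ⟨γ, iγ, g₁, g₂⟩ := exists_gluing π₁ π₂ (b₁.trans a₂.symm)
  have m₂ : Measurable fun w : (Space d × Space d) × Space d => (w.1.2, w.2) := by fun_prop
  have m₃ : Measurable fun w : (Space d × Space d) × Space d => (w.1.1, w.2) := by fun_prop
  have hc : γ.map (fun w => (w.1.1, w.2)) ∈ couplings μ ρ := by
    refine ⟨Measure.isProbabilityMeasure_map m₃.aemeasurable, ?_, ?_⟩
    · rw [Measure.map_map measurable_fst m₃, ← a₁, ← g₁,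
        Measure.map_map measurable_fst measurable_fst]; rfl
    · rw [Measure.map_map measurable_snd m₃, ← b₂, ← g₂,
        Measure.map_map measurable_snd m₂]; rfl
  refine (iInf₂_le _ hc).trans ?_
  rw [lintegral_map measurable_enorm_sub_rpow m₃, ← g₁, ← g₂,
    lintegral_map measurable_enorm_sub_rpow measurable_fst,
    lintegral_map measurable_enorm_sub_rpow m₂]
  refine le_trans ?_ (ENNReal.lintegral_Lp_add_le (μ := γ)
    (f := fun w => ‖w.1.1 - w.1.2‖ₑ) (g := fun w => ‖w.1.2 - w.2‖ₑ)
    (by fun_prop) (by fun_prop) hp)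
  refine ENNReal.rpow_le_rpow (lintegral_mono fun w => ?_) (by positivity)
  refine ENNReal.rpow_le_rpow ?_ (by linarith)
  simpa using enorm_add_le (w.1.1 - w.1.2) (w.1.2 - w.2)

/-- The `p`-th moment is controlled by the distance to a fixed measure. -/
theorem moment_rpow_le (hp : 1 ≤ p) (μ ν : Measure (Space d)) :
    (∫⁻ x, ‖x‖ₑ ^ p ∂μ) ^ (1 / p) ≤
      wassersteinEDist p μ ν + (∫⁻ x, ‖x‖ₑ ^ p ∂ν) ^ (1 / p) := by
  rw [wassersteinEDist]
  simp only [ENNReal.iInf_add]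
  refine le_iInf₂ fun π hπ => ?_
  obtain ⟨-, a, b⟩ := hπ
  have hm : Measurable fun x : Space d => ‖x‖ₑ ^ p := by fun_prop
  rw [← a, ← b, lintegral_map hm measurable_fst, lintegral_map hm measurable_snd]
  refine le_trans ?_ (ENNReal.lintegral_Lp_add_le (μ := π)
    (f := fun w => ‖w.1 - w.2‖ₑ) (g := fun w => ‖w.2‖ₑ) (by fun_prop) (by fun_prop) hp)
  refine ENNReal.rpow_le_rpow (lintegral_mono fun w => ?_) (by positivity)
  refine ENNReal.rpow_le_rpow ?_ (by linarith)
  simpa using enorm_add_le (w.1 - w.2) w.2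

/-- Markov's inequality bounds the Lévy–Prokhorov distance by the Wasserstein distance. -/
theorem levyProkhorovEDist_le_of_wassersteinEDist_lt (hp : 0 < p) (μ ν : Measure (Space d))
    [IsProbabilityMeasure μ] [IsProbabilityMeasure ν] {ε : ℝ} (hε : 0 < ε)
    (h : wassersteinEDist p μ ν < ENNReal.ofReal ε * ENNReal.ofReal ε ^ (1 / p)) :
    levyProkhorovEDist μ ν ≤ ENNReal.ofReal ε := by
  obtain ⟨π, hπ, hlt⟩ : ∃ π ∈ couplings μ ν,
      (∫⁻ z, ‖z.1 - z.2‖ₑ ^ p ∂π) ^ (1 / p) < ENNReal.ofReal ε * ENNReal.ofReal ε ^ (1 / p) := by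
    simpa [wassersteinEDist, iInf_lt_iff] using h
  obtain ⟨iπ, a, b⟩ := hπ
  -- The threshold is chosen so that its `p`-th power is `ε^p · ε`: Markov divides by `ε^p` and
  -- leaves mass `ε`.
  have hint : ∫⁻ z, ‖z.1 - z.2‖ₑ ^ p ∂π ≤ ENNReal.ofReal ε ^ p * ENNReal.ofReal ε := by
    have := ENNReal.rpow_le_rpow hlt.le hp.le
    rw [← ENNReal.rpow_mul, one_div_mul_cancel hp.ne', ENNReal.rpow_one,
      ENNReal.mul_rpow_of_nonneg _ _ hp.le, ← ENNReal.rpow_mul,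
      one_div_mul_cancel hp.ne', ENNReal.rpow_one] at this
    exact this
  have hmk : π {z | ENNReal.ofReal ε ≤ ‖z.1 - z.2‖ₑ} ≤ ENNReal.ofReal ε := by
    have h1 := mul_meas_ge_le_lintegral (μ := π) (measurable_enorm_sub_rpow (d := d) (p := p))
      (ENNReal.ofReal ε ^ p)
    have h2 : {z : Space d × Space d | ENNReal.ofReal ε ^ p ≤ ‖z.1 - z.2‖ₑ ^ p} =
        {z | ENNReal.ofReal ε ≤ ‖z.1 - z.2‖ₑ} := by
      ext z; simp [ENNReal.rpow_le_rpow_iff hp]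
    rw [h2] at h1
    have h0 : ENNReal.ofReal ε ^ p ≠ 0 := by simp [hε, hp]
    have ht : ENNReal.ofReal ε ^ p ≠ ∞ := by simp [hp.le]
    exact (ENNReal.mul_le_mul_iff_right h0 ht).1 (h1.trans hint)
  refine levyProkhorovEDist_le_of_forall_le μ ν _ fun r B hr hrt hB => ?_
  have hT : MeasurableSet (Metric.thickening r.toReal B) := Metric.isOpen_thickening.measurableSet
  rw [← a, ← b, Measure.map_apply measurable_fst hB, Measure.map_apply measurable_snd hT]
  have hsub : Prod.fst ⁻¹' B ⊆ (Prod.snd ⁻¹' Metric.thickening r.toReal B) ∪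
      {z : Space d × Space d | ENNReal.ofReal ε ≤ ‖z.1 - z.2‖ₑ} := by
    intro z hz
    by_cases hz' : ENNReal.ofReal ε ≤ ‖z.1 - z.2‖ₑ
    · exact Or.inr hz'
    · refine Or.inl (Metric.mem_thickening_iff.2 ⟨z.1, hz, ?_⟩)
      have h3 : ‖z.1 - z.2‖ₑ < r := (not_le.1 hz').trans hr
      rw [dist_comm, dist_eq_norm]
      rw [← toReal_enorm]
      exact (ENNReal.toReal_lt_toReal (by simp) hrt.ne).2 h3
  exact (measure_mono hsub).trans ((measure_union_le _ _).trans (add_le_add le_rfl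
    (hmk.trans hr.le)))

end Wasserstein

/-! ### Narrow convergence: lower semicontinuity and compactness. -/

section Narrow

variable {E : Type*} [MeasurableSpace E]

/-- The integral of a nonnegative continuous function is lower semicontinuous for narrow
convergence. -/
theorem lintegral_le_liminf_of_tendsto [TopologicalSpace E] [TopologicalSpace.PseudoMetrizableSpace E] [OpensMeasurableSpace E]
    {μs : ℕ → ProbabilityMeasure E}
    {μ : ProbabilityMeasure E} (h : Tendsto μs atTop (𝓝 μ)) {f : E → ℝ} (hf : Continuous f)
    (h0 : 0 ≤ f) :
    ∫⁻ x, ENNReal.ofReal (f x) ∂(μ : Measure E) ≤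
      liminf (fun k => ∫⁻ x, ENNReal.ofReal (f x) ∂(μs k : Measure E)) atTop := by
  let := TopologicalSpace.pseudoMetrizableSpacePseudoMetric E
  exact lintegral_le_liminf_lintegral_of_forall_isOpen_measure_le_liminf_measure hf h0
    fun G hG => ProbabilityMeasure.le_liminf_measure_open_of_tendsto h hG

theorem enorm_rpow_eq_ofReal {E : Type*} [NormedAddCommGroup E] {p : ℝ} (hp : 0 ≤ p) (x : E) :
    ‖x‖ₑ ^ p = ENNReal.ofReal (‖x‖ ^ p) := by
  rw [← ofReal_norm, ENNReal.ofReal_rpow_of_nonneg (norm_nonneg x) hp]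

variable [NormedAddCommGroup E] [BorelSpace E]

theorem moment_le_liminf_of_tendsto {p : ℝ} (hp : 0 ≤ p) {μs : ℕ → ProbabilityMeasure E}
    {μ : ProbabilityMeasure E} (h : Tendsto μs atTop (𝓝 μ)) :
    ∫⁻ x, ‖x‖ₑ ^ p ∂(μ : Measure E) ≤ liminf (fun k => ∫⁻ x, ‖x‖ₑ ^ p ∂(μs k : Measure E)) atTop := by
  simp only [enorm_rpow_eq_ofReal hp]
  exact lintegral_le_liminf_of_tendsto h (continuous_norm.rpow_const fun _ => Or.inr hp)
    fun x => by positivity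

/-- Probability measures with uniformly bounded `p`-th moment form a narrowly compact set. -/
theorem isCompact_setOf_moment_le [ProperSpace E] {p : ℝ} (hp : 0 < p) {R : ℝ≥0∞} (hR : R ≠ ∞) :
    IsCompact {μ : ProbabilityMeasure E | ∫⁻ x, ‖x‖ₑ ^ p ∂(μ : Measure E) ≤ R} := by
  set S := {μ : ProbabilityMeasure E | ∫⁻ x, ‖x‖ₑ ^ p ∂(μ : Measure E) ≤ R} with hS
  have hclosed : IsClosed S := by
    refine IsSeqClosed.isClosed fun μs μ hμs h => ?_
    refine (moment_le_liminf_of_tendsto hp.le h).trans ?_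
    refine (liminf_le_liminf (Eventually.of_forall hμs)).trans ?_
    simp
  have htight : IsTightMeasureSet {((μ : ProbabilityMeasure E) : Measure E) | μ ∈ S} := by
    refine isTightMeasureSet_of_tendsto_measure_norm_gt ?_
    have hb : ∀ r : ℝ, 0 < r →
        (⨆ μ ∈ {((μ : ProbabilityMeasure E) : Measure E) | μ ∈ S}, μ {x | r < ‖x‖}) ≤
          R / ENNReal.ofReal r ^ p := by
      intro r hr
      refine iSup₂_le ?_
      rintro _ ⟨μ, hμ, rfl⟩
      have h0 : ENNReal.ofReal r ^ p ≠ 0 := by simp [hr, hp]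
      have ht : ENNReal.ofReal r ^ p ≠ ∞ := by simp [hp.le]
      have hm : Measurable fun x : E => ‖x‖ₑ ^ p := by fun_prop
      rw [ENNReal.le_div_iff_mul_le (Or.inl h0) (Or.inl ht), mul_comm]
      refine le_trans ?_ ((mul_meas_ge_le_lintegral hm (ENNReal.ofReal r ^ p)).trans hμ)
      gcongr with x
      intro hx
      rw [← ofReal_norm]
      exact ENNReal.rpow_le_rpow (ENNReal.ofReal_le_ofReal (le_of_lt hx)) hp.le
    refine tendsto_of_tendsto_of_tendsto_of_le_of_le' tendsto_const_nhds ?_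
      (Eventually.of_forall fun _ => zero_le) ((eventually_gt_atTop 0).mono hb)
    have h1 : Tendsto (fun r : ℝ => ENNReal.ofReal r ^ p) atTop (𝓝 ∞) := by
      have := (ENNReal.continuous_rpow_const (y := p)).tendsto ∞
      rw [ENNReal.top_rpow_of_pos hp] at this
      exact this.comp ENNReal.tendsto_ofReal_atTop
    simpa using ENNReal.Tendsto.const_div h1 (Or.inr hR)
  have := isCompact_closure_of_isTightMeasureSet htight
  rwa [hclosed.closure_eq] at this

end Narrow

/-- The Wasserstein distance is lower semicontinuous for narrow convergence of measures with
bounded moments. -/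
theorem wassersteinEDist_le_liminf {d : ℕ} {p : ℝ} (hp : 0 < p) {R : ℝ≥0∞} (hR : R ≠ ∞)
    {μs νs : ℕ → ProbabilityMeasure (Space d)} {μ ν : ProbabilityMeasure (Space d)}
    (hμ : Tendsto μs atTop (𝓝 μ)) (hν : Tendsto νs atTop (𝓝 ν))
    (hμR : ∀ k, ∫⁻ x, ‖x‖ₑ ^ p ∂(μs k : Measure (Space d)) ≤ R)
    (hνR : ∀ k, ∫⁻ x, ‖x‖ₑ ^ p ∂(νs k : Measure (Space d)) ≤ R) :
    wassersteinEDist p (μ : Measure (Space d)) (ν : Measure (Space d)) ≤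
      liminf (fun k => wassersteinEDist p (μs k : Measure (Space d)) (νs k)) atTop := by
  refine le_of_forall_gt fun c hc => ?_
  -- Only non-strict bounds survive the narrow limit, so room is left between the liminf and `c`.
  obtain ⟨c', hc', hcc⟩ := exists_between hc
  refine lt_of_le_of_lt ?_ hcc
  obtain ⟨φ, hφ, hφc⟩ := extraction_of_frequently_atTop (frequently_lt_of_liminf_lt (by isBoundedDefault) hc')
  have hex : ∀ k, ∃ π : ProbabilityMeasure (Space d × Space d),
      (π : Measure (Space d × Space d)) ∈ couplings (μs (φ k) : Measure (Space d)) (νs (φ k)) ∧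
      (∫⁻ z, ‖z.1 - z.2‖ₑ ^ p ∂(π : Measure (Space d × Space d))) ^ (1 / p) < c' := by
    intro k
    obtain ⟨π, hπ, hlt⟩ : ∃ π ∈ couplings (μs (φ k) : Measure (Space d)) (νs (φ k)),
        (∫⁻ z, ‖z.1 - z.2‖ₑ ^ p ∂π) ^ (1 / p) < c' := by
      simpa [wassersteinEDist, iInf_lt_iff] using hφc k
    exact ⟨⟨π, hπ.1⟩, hπ, hlt⟩
  choose π hπ hlt using hex
  have hmom : ∀ k, π k ∈ {γ : ProbabilityMeasure (Space d × Space d) |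
      ∫⁻ z, ‖z‖ₑ ^ p ∂(γ : Measure (Space d × Space d)) ≤ R + R} := by
    intro k
    have hm : Measurable fun x : Space d => ‖x‖ₑ ^ p := by fun_prop
    have h1 := hμR (φ k)
    have h2 := hνR (φ k)
    rw [← (hπ k).2.1, lintegral_map hm measurable_fst] at h1
    rw [← (hπ k).2.2, lintegral_map hm measurable_snd] at h2
    refine le_trans ?_ (add_le_add h1 h2)
    rw [← lintegral_add_left (by fun_prop)]
    refine lintegral_mono fun z => ?_
    -- The product carries the sup norm, so the larger coordinate alone accounts for `‖z‖ₑ`.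
    rcases le_total ‖z.1‖ ‖z.2‖ with h | h
    · have : ‖z‖ₑ = ‖z.2‖ₑ := by
        rw [← ofReal_norm, ← ofReal_norm, Prod.norm_def, sup_eq_right.2 h]
      simp only [this]; exact le_add_self
    · have : ‖z‖ₑ = ‖z.1‖ₑ := by
        rw [← ofReal_norm, ← ofReal_norm, Prod.norm_def, sup_eq_left.2 h]
      simp only [this]; exact le_self_add
  obtain ⟨γ, -, ψ, hψ, hγ⟩ :=
    (isCompact_setOf_moment_le hp (ENNReal.add_ne_top.2 ⟨hR, hR⟩)).tendsto_subseq hmom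
  have hmarg : ∀ (f : Space d × Space d → Space d) (hf : Continuous f)
      (ρs : ℕ → ProbabilityMeasure (Space d)) (ρ : ProbabilityMeasure (Space d)),
      Tendsto ρs atTop (𝓝 ρ) →
      (∀ k, (π k : Measure (Space d × Space d)).map f = ρs (φ k)) →
      (γ : Measure (Space d × Space d)).map f = ρ := by
    intro f hf ρs ρ hρ hmap
    have h1 := ProbabilityMeasure.tendsto_map_of_tendsto_of_continuous _ _ hγ hf
    have h2 : Tendsto (fun k => ρs (φ (ψ k))) atTop (𝓝 ρ) :=
      hρ.comp (hφ.tendsto_atTop.comp hψ.tendsto_atTop)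
    have h3 : (fun k => (π (ψ k)).map hf.aemeasurable) = fun k => ρs (φ (ψ k)) := by
      funext k
      exact Subtype.ext (hmap (ψ k))
    have h4 : γ.map hf.aemeasurable = ρ := tendsto_nhds_unique (h3 ▸ h1) h2
    exact congrArg Subtype.val h4
  have hc : (γ : Measure (Space d × Space d)) ∈ couplings (μ : Measure (Space d)) ν :=
    ⟨γ.2, hmarg _ continuous_fst μs μ hμ fun k => (hπ k).2.1,
      hmarg _ continuous_snd νs ν hν fun k => (hπ k).2.2⟩
  refine (iInf₂_le _ hc).trans ?_
  rw [one_div, ENNReal.rpow_inv_le_iff hp]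
  simp only [enorm_rpow_eq_ofReal hp.le]
  refine (lintegral_le_liminf_of_tendsto hγ
    ((continuous_fst.sub continuous_snd).norm.rpow_const fun _ => Or.inr hp.le)
    fun x => by positivity).trans ?_
  refine (liminf_le_liminf (v := fun _ => c' ^ p) (Eventually.of_forall fun k => ?_)).trans (by simp)
  have := (hlt (ψ k)).le
  rw [one_div, ENNReal.rpow_inv_le_iff hp] at this
  simpa only [enorm_rpow_eq_ofReal hp.le, Function.comp, Pi.sub_apply] using this

/-- Fatou's lemma for a finite sum of Dirac masses. -/
theorem sum_liminf_le_liminf_sum {ι : Type*} (s : Finset ι) (u : ι → ℕ → ℝ≥0∞) :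
    ∑ i ∈ s, liminf (u i) atTop ≤ liminf (fun k => ∑ i ∈ s, u i k) atTop := by
  let _ : MeasurableSpace ι := ⊤
  have h := lintegral_liminf_le (μ := ∑ i ∈ s, Measure.dirac i) (u := atTop)
    (f := fun k i => u i k)
    fun _ => measurable_from_top
  simpa [lintegral_finsetSum_measure] using h

/-- Hölder against the constant `1`; the source of every exponent `1 - 1 / p` below. -/
theorem setLIntegral_le_rpow_mul_volume_rpow {p : ℝ} (hp : 1 < p) {g : ℝ → ℝ≥0∞}
    (hg : Measurable g) (A : Set ℝ) :
    ∫⁻ u in A, g u ≤ (∫⁻ u in A, g u ^ p) ^ (1 / p) * volume A ^ (1 - 1 / p) := by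
  have hpq : p.HolderConjugate (p.conjExponent) := Real.HolderConjugate.conjExponent hp
  have h := ENNReal.lintegral_mul_le_Lp_mul_Lq (volume.restrict A) hpq (f := g) (g := fun _ => 1)
    hg.aemeasurable aemeasurable_const
  have h2 : 1 / p.conjExponent = 1 - 1 / p := by
    have := hpq.inv_add_inv_eq_one
    simp only [one_div]; linarith
  simpa [h2] using h

/-! ### Absolutely continuous paths and their lower speed in a pseudometric space. -/

section Paths

variable {X : Type*} [PseudoMetricSpace X]

/-- The lower right metric speed of a path. -/
def lowerSpeed (ρ : ℝ → X) (s : ℝ) : ℝ≥0∞ :=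
  liminf (fun n : ℕ => ((n : ℝ≥0∞) + 1) * edist (ρ s) (ρ (s + 1 / ((n : ℝ) + 1)))) atTop

theorem measurable_edist_shift {ρ : ℝ → X} (hρ : Continuous ρ) (c : ℝ≥0∞) (δ : ℝ) :
    Measurable fun s => c * edist (ρ s) (ρ (s + δ)) := by
  have : Continuous fun s => edist (ρ s) (ρ (s + δ)) := by fun_prop
  exact this.measurable.const_mul c

theorem measurable_lowerSpeed {ρ : ℝ → X} (hρ : Continuous ρ) : Measurable (lowerSpeed ρ) :=
  Measurable.liminf fun _ => measurable_edist_shift hρ _ _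

theorem absolutelyContinuousOnInterval_dist_left {ρ : ℝ → X} {a b : ℝ} (x : X)
    (h : AbsolutelyContinuousOnInterval ρ a b) :
    AbsolutelyContinuousOnInterval (fun s => dist x (ρ s)) a b :=
  squeeze_zero (fun _ => Finset.sum_nonneg fun _ _ => dist_nonneg)
    (fun _ => Finset.sum_le_sum fun i _ => by
      rw [Real.dist_eq]
      simp only [dist_comm x]
      exact abs_dist_sub_le _ _ _) h

/-- The distance between two points of an absolutely continuous path is at most the integral of its
lower speed. -/
theorem edist_le_lintegral_lowerSpeed {ρ : ℝ → X} {a b : ℝ} (hab : a ≤ b)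
    (h : AbsolutelyContinuousOnInterval ρ a b) :
    edist (ρ a) (ρ b) ≤ ∫⁻ s in Ioc a b, lowerSpeed ρ s := by
  set f : ℝ → ℝ := fun s => dist (ρ a) (ρ s) with hf
  have hac : AbsolutelyContinuousOnInterval f a b :=
    absolutelyContinuousOnInterval_dist_left _ h
  have h1 : edist (ρ a) (ρ b) = ‖∫ s in a..b, deriv f s‖ₑ := by
    rw [hac.integral_deriv_eq_sub]
    simp [hf, edist_dist, Real.enorm_eq_ofReal dist_nonneg]
  rw [h1, intervalIntegral.integral_of_le hab]
  refine (enorm_integral_le_lintegral_enorm _).trans (lintegral_mono_ae ?_)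
  filter_upwards [ae_restrict_of_ae hac.ae_differentiableAt, ae_restrict_mem measurableSet_Ioc]
    with s hs hsI
  have hd := (hs (by rw [uIcc_of_le hab]; exact Ioc_subset_Icc_self hsI)).hasDerivAt
  have hδ : Tendsto (fun n : ℕ => 1 / ((n : ℝ) + 1)) atTop (𝓝[≠] 0) :=
    tendsto_nhdsWithin_iff.2 ⟨tendsto_one_div_add_atTop_nhds_zero_nat,
      Eventually.of_forall fun n => by simp only [mem_compl_iff, mem_singleton_iff]; positivity⟩
  have ht := ((hasDerivAt_iff_tendsto_slope_zero.1 hd).comp hδ).enorm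
  -- `‖f'(s)‖` is the limit of the slopes with steps `1 / (n + 1)`, and the reverse triangle
  -- inequality bounds each slope by the quotient in `lowerSpeed`.
  rw [← ht.liminf_eq]
  refine liminf_le_liminf (Eventually.of_forall fun n => ?_)
  simp only [Function.comp, one_div, inv_inv, smul_eq_mul, enorm_mul]
  refine mul_le_mul' (le_of_eq ?_) ?_
  · rw [Real.enorm_eq_ofReal (by positivity), ENNReal.ofReal_add (by positivity) zero_le_one]
    simp
  · rw [edist_dist, Real.enorm_eq_ofReal_abs]
    refine ENNReal.ofReal_le_ofReal ?_
    simp only [hf]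
    rw [dist_comm (ρ s), dist_comm (ρ a), dist_comm (ρ a)]
    exact abs_dist_sub_le _ _ _

/-- The lower speed is at most any integrable speed bound. -/
theorem lowerSpeed_le_ae {ρ : ℝ → X} {g : ℝ → ℝ≥0∞} (hg : Measurable g)
    (hfin : ∫⁻ u, g u ≠ ∞)
    (hb : ∀ a b, a ≤ b → edist (ρ a) (ρ b) ≤ ∫⁻ u in Ioc a b, g u) :
    lowerSpeed ρ ≤ᵐ[volume] g := by
  have hint : Integrable (fun u => (g u).toReal) :=
    integrable_toReal_of_lintegral_ne_top hg.aemeasurable hfin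
  filter_upwards [LocallyIntegrable.ae_hasDerivAt_integral hint.locallyIntegrable, ae_lt_top hg hfin]
    with s hs hlt
  have hδ : Tendsto (fun n : ℕ => 1 / ((n : ℝ) + 1)) atTop (𝓝[≠] 0) :=
    tendsto_nhdsWithin_iff.2 ⟨tendsto_one_div_add_atTop_nhds_zero_nat,
      Eventually.of_forall fun n => by simp only [mem_compl_iff, mem_singleton_iff]; positivity⟩
  -- At almost every `s` the averages of `g` over `(s, s + 1 / (n + 1)]` tend to `g s`, and they
  -- dominate the quotients of `ρ`.
  have ht := ENNReal.tendsto_ofReal ((hasDerivAt_iff_tendsto_slope_zero.1 (hs s)).comp hδ)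
  rw [ENNReal.ofReal_toReal hlt.ne] at ht
  rw [← ht.liminf_eq]
  refine liminf_le_liminf (Eventually.of_forall fun n => ?_)
  have hle : s ≤ s + 1 / ((n : ℝ) + 1) := by
    have : (0 : ℝ) ≤ 1 / ((n : ℝ) + 1) := by positivity
    linarith
  simp only [Function.comp, intervalIntegral.integral_same, sub_zero, smul_eq_mul]
  rw [ENNReal.ofReal_mul (by positivity)]
  refine mul_le_mul' (le_of_eq ?_) ?_
  · rw [one_div, inv_inv, ENNReal.ofReal_add (by positivity) zero_le_one]
    simp
  · refine (hb _ _ hle).trans (le_of_eq ?_)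
    rw [intervalIntegral.integral_of_le hle, integral_toReal hg.aemeasurable
      (ae_restrict_of_ae (ae_lt_top hg hfin)), ENNReal.ofReal_toReal]
    exact ne_top_of_le_ne_top hfin (setLIntegral_le_lintegral _ _)

/-- Tonelli after moving the window to `(0, δ]`, then translation invariance. -/
theorem lintegral_setLIntegral_Ioc_shift {G : ℝ → ℝ≥0∞} (hG : Measurable G) (δ : ℝ) :
    ∫⁻ s, ∫⁻ u in Ioc s (s + δ), G u = ENNReal.ofReal δ * ∫⁻ u, G u := by
  have h1 : ∀ s : ℝ, ∫⁻ u in Ioc s (s + δ), G u = ∫⁻ u in Ioc 0 δ, G (s + u) := by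
    intro s
    rw [← lintegral_indicator measurableSet_Ioc, ← lintegral_indicator measurableSet_Ioc,
      ← lintegral_add_left_eq_self _ s]
    refine lintegral_congr fun u => ?_
    have : s + u ∈ Ioc s (s + δ) ↔ u ∈ Ioc 0 δ := by simp
    by_cases hu : u ∈ Ioc 0 δ
    · rw [indicator_of_mem (this.2 hu), indicator_of_mem hu]
    · rw [indicator_of_notMem (fun h => hu (this.1 h)), indicator_of_notMem hu]
  simp only [h1]
  rw [lintegral_lintegral_swap (by fun_prop)]
  simp only [lintegral_add_right_eq_self G]
  simp [mul_comm]

/-- The difference quotients of a path are bounded in `L^p` by any speed bound. -/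
theorem lintegral_diffQuot_rpow_le {p : ℝ} (hp : 1 < p) {ρ : ℝ → X} {g : ℝ → ℝ≥0∞}
    (hg : Measurable g) (hb : ∀ a b, a ≤ b → edist (ρ a) (ρ b) ≤ ∫⁻ u in Ioc a b, g u) (n : ℕ) :
    ∫⁻ s, (((n : ℝ≥0∞) + 1) * edist (ρ s) (ρ (s + 1 / ((n : ℝ) + 1)))) ^ p ≤ ∫⁻ u, g u ^ p := by
  have hp0 : 0 < p := by linarith
  set N : ℝ≥0∞ := (n : ℝ≥0∞) + 1 with hN
  have hN0 : N ≠ 0 := by simp [hN]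
  have hNt : N ≠ ∞ := by simp [hN]
  have hδ : ENNReal.ofReal (1 / ((n : ℝ) + 1)) = N⁻¹ := by
    rw [one_div, ENNReal.ofReal_inv_of_pos (by positivity),
      ENNReal.ofReal_add (by positivity) zero_le_one]
    simp [hN]
  have key : ∀ s, (N * edist (ρ s) (ρ (s + 1 / ((n : ℝ) + 1)))) ^ p ≤
      N * ∫⁻ u in Ioc s (s + 1 / ((n : ℝ) + 1)), g u ^ p := by
    intro s
    have hle : s ≤ s + 1 / ((n : ℝ) + 1) := by
      have : (0 : ℝ) ≤ 1 / ((n : ℝ) + 1) := by positivity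
      linarith
    have h1 := (hb _ _ hle).trans (setLIntegral_le_rpow_mul_volume_rpow hp hg _)
    rw [Real.volume_Ioc, add_sub_cancel_left, hδ] at h1
    have h2 := ENNReal.rpow_le_rpow (mul_le_mul' (le_refl N) h1) hp0.le
    refine h2.trans (le_of_eq ?_)
    rw [ENNReal.mul_rpow_of_nonneg _ _ hp0.le, ENNReal.mul_rpow_of_nonneg _ _ hp0.le,
      ← ENNReal.rpow_mul, one_div_mul_cancel hp0.ne', ENNReal.rpow_one, ← ENNReal.rpow_mul,
      ENNReal.inv_rpow, ← ENNReal.rpow_neg, mul_left_comm, ← ENNReal.rpow_add _ _ hN0 hNt]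
    -- Hölder gains the window length `N⁻¹` to the power `p - 1`, leaving one factor `N`;
    -- integrating over all windows cancels it.
    have : p + -((1 - 1 / p) * p) = 1 := by field_simp; ring
    rw [this, ENNReal.rpow_one, mul_comm]
  refine (lintegral_mono key).trans ?_
  rw [lintegral_const_mul' _ _ hNt, lintegral_setLIntegral_Ioc_shift (by fun_prop), hδ, ← mul_assoc,
    ENNReal.mul_inv_cancel hN0 hNt, one_mul]

theorem edist_le_setLIntegral_uIoc {ρ : ℝ → X} {g : ℝ → ℝ≥0∞}
    (hb : ∀ a b, a ≤ b → edist (ρ a) (ρ b) ≤ ∫⁻ u in Ioc a b, g u) (a b : ℝ) :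
    edist (ρ a) (ρ b) ≤ ∫⁻ u in uIoc a b, g u := by
  rcases le_total a b with h | h
  · rw [uIoc_of_le h]; exact hb a b h
  · rw [uIoc_of_ge h, edist_comm]; exact hb b a h

-- Disjointness merges the integrals into one over the union, so Hölder is applied once and the
-- bound does not depend on the number of intervals.
open AbsolutelyContinuousOnInterval in
theorem sum_edist_le_of_disjWithin {p : ℝ} (hp : 1 < p) {ρ : ℝ → X} {g : ℝ → ℝ≥0∞}
    (hg : Measurable g) (hb : ∀ a b, a ≤ b → edist (ρ a) (ρ b) ≤ ∫⁻ u in Ioc a b, g u)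
    {a b : ℝ} {E : ℕ × (ℕ → ℝ × ℝ)} (hE : E ∈ disjWithin a b) :
    ∑ i ∈ Finset.range E.1, edist (ρ (E.2 i).1) (ρ (E.2 i).2) ≤
      (∫⁻ u, g u ^ p) ^ (1 / p) *
        volume (⋃ i ∈ Finset.range E.1, uIoc (E.2 i).1 (E.2 i).2) ^ (1 - 1 / p) := by
  have hp0 : 0 < p := by linarith
  refine (Finset.sum_le_sum fun i _ => edist_le_setLIntegral_uIoc hb _ _).trans ?_
  rw [← lintegral_biUnion_finset hE.2 fun i _ => measurableSet_uIoc]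
  refine (setLIntegral_le_rpow_mul_volume_rpow hp hg _).trans ?_
  gcongr
  exact Measure.restrict_le_self

open AbsolutelyContinuousOnInterval in
theorem absolutelyContinuousOnInterval_of_sum_edist_le {ρ : ℝ → X} {a b : ℝ} {C : ℝ≥0∞}
    (hC : C ≠ ∞) {r : ℝ} (hr : 0 < r)
    (h : ∀ E ∈ disjWithin a b, ∑ i ∈ Finset.range E.1, edist (ρ (E.2 i).1) (ρ (E.2 i).2) ≤
      C * volume (⋃ i ∈ Finset.range E.1, uIoc (E.2 i).1 (E.2 i).2) ^ r) :
    AbsolutelyContinuousOnInterval ρ a b := by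
  have h0 : Tendsto (fun E : ℕ × (ℕ → ℝ × ℝ) =>
      volume (⋃ i ∈ Finset.range E.1, uIoc (E.2 i).1 (E.2 i).2))
      (totalLengthFilter ⊓ 𝓟 (disjWithin a b)) (𝓝 0) :=
    tendsto_volume_totalLengthFilter_nhds_zero.mono_left inf_le_left
  have h1 : Tendsto (fun E : ℕ × (ℕ → ℝ × ℝ) =>
      C * volume (⋃ i ∈ Finset.range E.1, uIoc (E.2 i).1 (E.2 i).2) ^ r)
      (totalLengthFilter ⊓ 𝓟 (disjWithin a b)) (𝓝 0) := by
    have h2 := (ENNReal.continuous_rpow_const (y := r)).tendsto 0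
    rw [ENNReal.zero_rpow_of_pos hr] at h2
    have h3 := ENNReal.Tendsto.const_mul (a := C) (h2.comp h0) (Or.inr hC)
    rwa [mul_zero] at h3
  have h4 := tendsto_of_tendsto_of_tendsto_of_le_of_le' tendsto_const_nhds h1
    (Eventually.of_forall fun _ => zero_le)
    (eventually_inf_principal.2 (Eventually.of_forall h))
  have h5 := (ENNReal.tendsto_toReal ENNReal.zero_ne_top).comp h4
  rw [ENNReal.toReal_zero] at h5
  refine h5.congr fun E => ?_
  simp only [Function.comp]
  rw [ENNReal.toReal_sum fun i _ => edist_ne_top _ _]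
  simp only [dist_edist]

theorem continuous_of_absolutelyContinuousOnInterval {ρ : ℝ → X}
    (h : ∀ a b, AbsolutelyContinuousOnInterval ρ a b) : Continuous ρ :=
  continuous_iff_continuousAt.2 fun s => by
    obtain ⟨a, ha⟩ := exists_lt s
    obtain ⟨b, hb⟩ := exists_gt s
    have h2 := (absolutelyContinuousOnInterval_dist_left (ρ s) (h a b)).continuousOn
    rw [uIcc_of_le (ha.trans hb).le] at h2
    have h3 := (h2.continuousAt (Icc_mem_nhds ha hb)).tendsto
    rw [dist_self] at h3
    refine tendsto_iff_dist_tendsto_zero.2 ?_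
    simpa only [dist_comm] using h3

/-! ### Passage to the limit along paths of bounded action. -/

section Limit

variable {p : ℝ} {ρ : ℕ → ℝ → X} {η : ℝ → X} {g : ℕ → ℝ → ℝ≥0∞}

/-- A limit of paths of uniformly bounded action is absolutely continuous, if the distance is lower
semicontinuous along the convergence. -/
theorem absolutelyContinuousOnInterval_of_liminf (hp : 1 < p) (hg : ∀ k, Measurable (g k))
    (hb : ∀ k a b, a ≤ b → edist (ρ k a) (ρ k b) ≤ ∫⁻ u in Ioc a b, g k u)
    {C : ℝ≥0∞} (hC : C ≠ ∞) (hgC : ∀ k, ∫⁻ u, g k u ^ p ≤ C)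
    (hη : ∀ a b, edist (η a) (η b) ≤ liminf (fun k => edist (ρ k a) (ρ k b)) atTop) (a b : ℝ) :
    AbsolutelyContinuousOnInterval η a b := by
  have hp0 : 0 < p := by linarith
  refine absolutelyContinuousOnInterval_of_sum_edist_le (C := C ^ (1 / p)) (r := 1 - 1 / p)
    (ENNReal.rpow_ne_top_of_nonneg (by positivity) hC) ?_ fun E hE => ?_
  · rw [sub_pos, div_lt_one hp0]; exact hp
  -- The liminf leaves the sum, and the bound for the approximating paths is uniform in `k`.
  · refine (Finset.sum_le_sum fun i _ => hη _ _).trans ((sum_liminf_le_liminf_sum _ _).trans ?_)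
    refine (liminf_le_liminf (Eventually.of_forall fun k =>
      (sum_edist_le_of_disjWithin hp (hg k) (hb k) hE).trans
        (mul_le_mul' (ENNReal.rpow_le_rpow (hgC k) (by positivity)) le_rfl))).trans ?_
    simp

/-- The action, expressed by the lower speed, is lower semicontinuous. -/
theorem lintegral_lowerSpeed_rpow_le_liminf (hp : 1 < p) (hg : ∀ k, Measurable (g k))
    (hb : ∀ k a b, a ≤ b → edist (ρ k a) (ρ k b) ≤ ∫⁻ u in Ioc a b, g k u)
    (hρ : ∀ k, Continuous (ρ k)) (hηc : Continuous η)
    (hη : ∀ a b, edist (η a) (η b) ≤ liminf (fun k => edist (ρ k a) (ρ k b)) atTop) :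
    ∫⁻ s, lowerSpeed η s ^ p ≤ liminf (fun k => ∫⁻ u, g k u ^ p) atTop := by
  have hp0 : 0 < p := by linarith
  have hpow : ∀ u : ℕ → ℝ≥0∞, (liminf u atTop) ^ p = liminf (fun n => u n ^ p) atTop := fun u =>
    (ENNReal.orderIsoRpow p hp0).liminf_apply
  -- Fatou is used twice: here in `k` at fixed step `1 / (n + 1)`, and afterwards in `n`.
  have hquot : ∀ n : ℕ,
      ∫⁻ s, (((n : ℝ≥0∞) + 1) * edist (η s) (η (s + 1 / ((n : ℝ) + 1)))) ^ p ≤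
        liminf (fun k => ∫⁻ u, g k u ^ p) atTop := by
    intro n
    have h1 : ∀ s, (((n : ℝ≥0∞) + 1) * edist (η s) (η (s + 1 / ((n : ℝ) + 1)))) ^ p ≤
        liminf (fun k => (((n : ℝ≥0∞) + 1) *
          edist (ρ k s) (ρ k (s + 1 / ((n : ℝ) + 1)))) ^ p) atTop := by
      intro s
      rw [← hpow, ENNReal.liminf_const_mul_of_ne_top (by simp)]
      exact ENNReal.rpow_le_rpow (mul_le_mul' le_rfl (hη _ _)) hp0.le
    refine (lintegral_mono h1).trans ((lintegral_liminf_le fun k =>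
      (measurable_edist_shift (hρ k) _ _).pow_const p).trans ?_)
    exact liminf_le_liminf (Eventually.of_forall fun k =>
      lintegral_diffQuot_rpow_le hp (hg k) (hb k) n)
  simp only [lowerSpeed, hpow]
  refine (lintegral_liminf_le fun n => (measurable_edist_shift hηc _ _).pow_const p).trans ?_
  refine (liminf_le_liminf (Eventually.of_forall hquot)).trans ?_
  simp

end Limit

end Paths

/-! ### Speed bounds in Wasserstein space and existence of the metric derivative. -/

section SpeedBounds

variable {d : ℕ} {p : ℝ}

instance (μ : ProbWithMoment d p) : IsProbabilityMeasure μ.meas := μ.1.2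

/-- A pseudometric suffices: that distance zero forces equality is never needed. -/
instance wassersteinPseudoMetricSpace [hp : Fact (1 < p)] :
    PseudoMetricSpace (ProbWithMoment d p) where
  dist := wassersteinDist
  edist μ ν := wassersteinEDist p μ.meas ν.meas
  dist_self μ := by
    simp [wassersteinDist, wassersteinEDist_self (zero_lt_one.trans hp.out) μ.meas]
  dist_comm μ ν := by simp only [wassersteinDist, wassersteinEDist_comm μ.meas]
  dist_triangle μ ν ρ := by
    have h1 := wassersteinEDist_ne_top hp.out.le μ ν
    have h2 := wassersteinEDist_ne_top hp.out.le ν ρ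
    simp only [wassersteinDist]
    rw [← ENNReal.toReal_add h1 h2]
    exact ENNReal.toReal_mono (ENNReal.add_ne_top.2 ⟨h1, h2⟩)
      (wassersteinEDist_triangle hp.out.le _ _ _)
  edist_dist μ ν := (ENNReal.ofReal_toReal (wassersteinEDist_ne_top hp.out.le μ ν)).symm

/-- The nearest point of `[0,t]`. -/
def clamp (t s : ℝ) : ℝ := max 0 (min t s)

theorem clamp_mem {t : ℝ} (ht : 0 ≤ t) (s : ℝ) : clamp t s ∈ Icc 0 t :=
  ⟨le_max_left _ _, max_le ht (min_le_left _ _)⟩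

theorem clamp_of_mem {t s : ℝ} (hs : s ∈ Icc 0 t) : clamp t s = s := by
  rw [clamp, min_eq_right hs.2, max_eq_right hs.1]

theorem clamp_mono (t : ℝ) : Monotone (clamp t) := fun _ _ h =>
  max_le_max le_rfl (min_le_min le_rfl h)

theorem Ioc_clamp_subset (t a b : ℝ) :
    Ioc (clamp t a) (clamp t b) ⊆ Ioc a b := by
  rintro u ⟨h1, h2⟩
  simp only [clamp, max_lt_iff, le_max_iff, le_min_iff, min_lt_iff] at h1 h2
  grind

/-- The path on the whole line that agrees with `σ` on `[0,t]` and is constant on either side. -/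
def clampPath {Y : Type*} (t : ℝ) (σ : ℝ → Y) (s : ℝ) : Y := σ (clamp t s)

namespace IsSpeedBound

variable {t : ℝ} {σ : ℝ → ProbWithMoment d p} {h : ℝ → ℝ}

theorem integrableOn [hp : Fact (1 < p)] (hh : IsSpeedBound t σ h) : IntegrableOn h (Icc 0 t) :=
  hh.1.integrable (by simpa using hp.out.le)

theorem intervalIntegrable [Fact (1 < p)] (hh : IsSpeedBound t σ h) {a b : ℝ} (ha : 0 ≤ a)
    (hab : a ≤ b) (hb : b ≤ t) : IntervalIntegrable h volume a b :=
  (intervalIntegrable_iff_integrableOn_Ioc_of_le hab).2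
    (hh.integrableOn.mono_set (Ioc_subset_Icc_self.trans (Icc_subset_Icc ha hb)))

theorem nonneg_ae [Fact (1 < p)] (ht : 0 ≤ t) (hh : IsSpeedBound t σ h) :
    0 ≤ᵐ[volume.restrict (Icc 0 t)] h := by
  -- Dropping the right endpoint leaves room for steps to the right, whose difference quotients of
  -- `∫ h` are nonnegative.
  rw [EventuallyLE, ← restrict_Ico_eq_restrict_Icc]
  filter_upwards [ae_restrict_of_ae (hh.intervalIntegrable le_rfl ht le_rfl).ae_hasDerivAt_integral,
    ae_restrict_mem measurableSet_Ico] with s hs hsI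
  have hsI' : s ∈ uIcc 0 t := by rw [uIcc_of_le ht]; exact Ico_subset_Icc_self hsI
  have hd := (hasDerivAt_iff_tendsto_slope_zero.1 (hs hsI' s hsI')).mono_left
    (nhdsWithin_mono (0 : ℝ) fun x (hx : x ∈ Ioi 0) => ne_of_gt hx)
  refine ge_of_tendsto hd ?_
  filter_upwards [Ioo_mem_nhdsGT (sub_pos.2 hsI.2)] with δ hδ
  have h1 := hh.2 s (s + δ) hsI.1 (by linarith [hδ.1]) (by linarith [hδ.2])
  have h2 : 0 ≤ wassersteinDist (σ s) (σ (s + δ)) := ENNReal.toReal_nonneg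
  have h3 := hδ.1
  simp only [intervalIntegral.integral_same, sub_zero, smul_eq_mul, Pi.zero_apply]
  exact mul_nonneg (by positivity) (h2.trans h1)

/-- Every speed bound on `[0,t]` gives a speed bound with values in `[0, ∞]` of the path extended
to the whole line. -/
theorem exists_extension [hp : Fact (1 < p)] (ht : 0 ≤ t) (hh : IsSpeedBound t σ h) :
    ∃ g : ℝ → ℝ≥0∞, Measurable g ∧
      g =ᵐ[volume.restrict (Icc 0 t)] (fun u => ENNReal.ofReal (h u)) ∧
      (∀ a b, a ≤ b → edist (clampPath t σ a) (clampPath t σ b) ≤ ∫⁻ u in Ioc a b, g u) ∧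
      ∫⁻ u, g u ≠ ∞ ∧
      ∫⁻ u, g u ^ p = ENNReal.ofReal (∫ u in (0 : ℝ)..t, h u ^ p) := by
  have hp0 : 0 < p := zero_lt_one.trans hp.out
  have hnn := hh.nonneg_ae ht
  set k := hh.1.1.mk h with hk
  have hkm : Measurable k := hh.1.1.stronglyMeasurable_mk.measurable
  set g : ℝ → ℝ≥0∞ := (Icc 0 t).indicator fun u => ENNReal.ofReal (k u) with hg
  have hgm : Measurable g := hkm.ennreal_ofReal.indicator measurableSet_Icc
  have hgh : g =ᵐ[volume.restrict (Icc 0 t)] (fun u => ENNReal.ofReal (h u)) := by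
    filter_upwards [hh.1.1.ae_eq_mk, ae_restrict_mem measurableSet_Icc] with u hu huI
    simp only [hg, indicator_of_mem huI, hk, hu]
  -- Needed for the identity and for the `p`-th power.
  have hint : ∀ q : ℝ≥0∞ → ℝ≥0∞, q 0 = 0 →
      ∫⁻ u, q (g u) = ∫⁻ u in Icc 0 t, q (ENNReal.ofReal (h u)) := by
    intro q hq
    have h1 : (fun u => q (g u)) = (Icc 0 t).indicator fun u => q (g u) := by
      funext u
      by_cases hu : u ∈ Icc 0 t
      · rw [indicator_of_mem hu]
      · rw [indicator_of_notMem hu, hg, indicator_of_notMem hu, hq]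
    rw [h1, lintegral_indicator measurableSet_Icc]
    exact lintegral_congr_ae (hgh.mono fun u hu => congrArg q hu)
  refine ⟨g, hgm, hgh, fun a b hab => ?_, ?_, ?_⟩
  · have ha := clamp_mem ht a
    have hb := clamp_mem ht b
    have hab' := clamp_mono t hab
    have hsub : Ioc (clamp t a) (clamp t b) ⊆ Icc 0 t :=
      Ioc_subset_Icc_self.trans (Icc_subset_Icc ha.1 hb.2)
    rw [edist_dist]
    calc ENNReal.ofReal (dist (clampPath t σ a) (clampPath t σ b))
        ≤ ENNReal.ofReal (∫ u in clamp t a..clamp t b, h u) :=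
          ENNReal.ofReal_le_ofReal (hh.2 _ _ ha.1 hab' hb.2)
      _ = ∫⁻ u in Ioc (clamp t a) (clamp t b), ENNReal.ofReal (h u) := by
          rw [intervalIntegral.integral_of_le hab', ofReal_integral_eq_lintegral_ofReal
            (hh.integrableOn.mono_set hsub) (ae_restrict_of_ae_restrict_of_subset hsub hnn)]
      _ = ∫⁻ u in Ioc (clamp t a) (clamp t b), g u :=
          lintegral_congr_ae (ae_restrict_of_ae_restrict_of_subset hsub hgh.symm)
      _ ≤ ∫⁻ u in Ioc a b, g u := lintegral_mono_set (Ioc_clamp_subset t a b)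
  · have h1 := hint id rfl
    simp only [id] at h1
    rw [h1, ← ofReal_integral_eq_lintegral_ofReal hh.integrableOn hnn]
    exact ENNReal.ofReal_ne_top
  · rw [hint (· ^ p) (ENNReal.zero_rpow_of_pos hp0), intervalIntegral.integral_of_le ht,
      ← integral_Icc_eq_integral_Ioc, ofReal_integral_eq_lintegral_ofReal]
    · refine lintegral_congr_ae (hnn.mono fun u hu => ?_)
      exact ENNReal.ofReal_rpow_of_nonneg hu hp0.le
    · have h1 := hh.1.integrable_norm_rpow (by simpa using hp0) ENNReal.ofReal_ne_top
      rw [ENNReal.toReal_ofReal hp0.le] at h1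
      refine h1.congr (hnn.mono fun u hu => ?_)
      simp only [Real.norm_of_nonneg (show 0 ≤ h u from hu)]
    · exact hnn.mono fun u hu => Real.rpow_nonneg hu p

end IsSpeedBound

variable {t : ℝ} {σ : ℝ → ProbWithMoment d p}

/-- The lower speed of an absolutely continuous path with finite action is its metric derivative. -/
theorem isMetricDerivative_lowerSpeed [hp : Fact (1 < p)] (ht : 0 ≤ t)
    (hac : ∀ a b, AbsolutelyContinuousOnInterval (clampPath t σ) a b)
    (hfin : ∫⁻ s, lowerSpeed (clampPath t σ) s ^ p ≠ ∞) :
    IsMetricDerivative t σ fun s => (lowerSpeed (clampPath t σ) s).toReal := by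
  have hp0 : 0 < p := zero_lt_one.trans hp.out
  set v := lowerSpeed (clampPath t σ) with hv
  have hvm : Measurable v :=
    measurable_lowerSpeed (continuous_of_absolutelyContinuousOnInterval hac)
  have hvt : ∀ᵐ s, v s < ∞ := by
    filter_upwards [ae_lt_top (hvm.pow_const p) hfin] with s hs
    exact (ENNReal.rpow_lt_top_iff_of_pos hp0).1 hs
  have hmem : MemLp (fun s => (v s).toReal) (ENNReal.ofReal p) (volume.restrict (Icc 0 t)) := by
    refine ⟨hvm.ennreal_toReal.aestronglyMeasurable, ?_⟩
    refine (eLpNorm_lt_top_iff_lintegral_rpow_enorm_lt_top (by simpa using hp0)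
      ENNReal.ofReal_ne_top).2 ?_
    rw [ENNReal.toReal_ofReal hp0.le]
    refine lt_of_le_of_lt ?_ (lt_top_iff_ne_top.2 hfin)
    refine (setLIntegral_le_lintegral _ _).trans (lintegral_mono fun s => ?_)
    refine ENNReal.rpow_le_rpow ?_ hp0.le
    rw [Real.enorm_eq_ofReal ENNReal.toReal_nonneg]
    exact ENNReal.ofReal_toReal_le
  have hIoc : ∀ a b : ℝ, ∫⁻ s in Ioc a b, v s ≠ ∞ := fun a b => by
    refine ne_top_of_le_ne_top ?_ (setLIntegral_le_rpow_mul_volume_rpow hp.out hvm (Ioc a b))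
    refine ENNReal.mul_ne_top (ENNReal.rpow_ne_top_of_nonneg (by positivity)
      (ne_top_of_le_ne_top hfin (setLIntegral_le_lintegral _ _))) ?_
    refine ENNReal.rpow_ne_top_of_nonneg ?_ (by simp)
    rw [sub_nonneg, div_le_one hp0]; exact hp.out.le
  refine ⟨⟨hmem, fun a b ha hab hb => ?_⟩, fun h hh => ?_⟩
  · have h1 := edist_le_lintegral_lowerSpeed hab (hac a b)
    have h2 := ENNReal.toReal_mono (hIoc a b) h1
    rw [← dist_edist] at h2
    simp only [clampPath, clamp_of_mem (⟨ha, hab.trans hb⟩ : a ∈ Icc 0 t),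
      clamp_of_mem (⟨ha.trans hab, hb⟩ : b ∈ Icc 0 t)] at h2
    rw [intervalIntegral.integral_of_le hab, integral_toReal hvm.aemeasurable
      (ae_restrict_of_ae hvt)]
    exact h2
  -- Minimality: a competitor, extended by zero, bounds the extended path on the whole line.
  · obtain ⟨g, hgm, hgh, hgb, hgf, -⟩ := hh.exists_extension ht
    filter_upwards [ae_restrict_of_ae (lowerSpeed_le_ae hgm hgf hgb), hgh, hh.nonneg_ae ht]
      with s h1 h2 h3
    rw [h2] at h1
    exact (ENNReal.toReal_mono ENNReal.ofReal_ne_top h1).trans (ENNReal.toReal_ofReal h3).le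

theorem isMetricDerivative_metricDerivative {m : ℝ → ℝ} (hm : IsMetricDerivative t σ m) :
    IsMetricDerivative t σ (metricDerivative t σ) := by
  have h : ∃ m, IsMetricDerivative t σ m := ⟨m, hm⟩
  rw [metricDerivative, dif_pos h]
  exact h.choose_spec

/-- Each side is a smallest speed bound. This carries results on the lower speed over to the chosen
representative. -/
theorem metricDerivative_ae_eq {m : ℝ → ℝ} (hm : IsMetricDerivative t σ m) :
    metricDerivative t σ =ᵐ[volume.restrict (Icc 0 t)] m :=
  have h := isMetricDerivative_metricDerivative hm
  (h.2 m hm.1).antisymm (hm.2 _ h.1)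

/-- Every path in `AC_p` has a metric derivative. -/
theorem isMetricDerivative_of_mem_ACp [hp : Fact (1 < p)] (ht : 0 ≤ t) (hσ : σ ∈ ACp d p t) :
    IsMetricDerivative t σ (metricDerivative t σ) := by
  have hp0 : 0 < p := zero_lt_one.trans hp.out
  obtain ⟨h, hh⟩ := hσ
  obtain ⟨g, hgm, -, hgb, hgf, hgp⟩ := hh.exists_extension ht
  have hpt : ∫⁻ u, g u ^ p ≠ ∞ := by rw [hgp]; exact ENNReal.ofReal_ne_top
  refine isMetricDerivative_metricDerivative (isMetricDerivative_lowerSpeed ht (fun a b => ?_) ?_)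
  · refine absolutelyContinuousOnInterval_of_sum_edist_le
      (ENNReal.rpow_ne_top_of_nonneg (y := 1 / p) (by positivity) hpt) (r := 1 - 1 / p) ?_
      fun E hE => sum_edist_le_of_disjWithin hp.out hgm hgb hE
    rw [sub_pos, div_lt_one hp0]; exact hp.out
  · refine ne_top_of_le_ne_top hpt (lintegral_mono_ae ?_)
    filter_upwards [lowerSpeed_le_ae hgm hgf hgb] with s hs
    exact ENNReal.rpow_le_rpow hs hp0.le

theorem pAction_eq_toReal_lintegral [hp : Fact (1 < p)] (ht : 0 ≤ t)
    (hac : ∀ a b, AbsolutelyContinuousOnInterval (clampPath t σ) a b)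
    (hfin : ∫⁻ s, lowerSpeed (clampPath t σ) s ^ p ≠ ∞) :
    pAction t σ = (∫⁻ s in Icc 0 t, lowerSpeed (clampPath t σ) s ^ p).toReal := by
  have hp0 : 0 < p := zero_lt_one.trans hp.out
  have hvm : Measurable (lowerSpeed (clampPath t σ)) :=
    measurable_lowerSpeed (continuous_of_absolutelyContinuousOnInterval hac)
  rw [pAction, intervalIntegral.integral_of_le ht, ← integral_Icc_eq_integral_Ioc,
    ← integral_toReal (hvm.pow_const p).aemeasurable
      (ae_restrict_of_ae (ae_lt_top (hvm.pow_const p) hfin))]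
  refine integral_congr_ae ?_
  filter_upwards [metricDerivative_ae_eq (isMetricDerivative_lowerSpeed ht hac hfin)] with s hs
  rw [hs, ENNReal.toReal_rpow]

theorem pAction_nonneg [Fact (1 < p)] (ht : 0 ≤ t) (hσ : σ ∈ ACp d p t) : 0 ≤ pAction t σ := by
  rw [pAction, intervalIntegral.integral_of_le ht, ← integral_Icc_eq_integral_Ioc]
  exact integral_nonneg_of_ae (((isMetricDerivative_of_mem_ACp ht hσ).1.nonneg_ae ht).mono
    fun s hs => Real.rpow_nonneg hs p)

end SpeedBounds

/-! ### Compactness of paths and semicontinuity of the action. -/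

section Compactness

variable {d : ℕ} {p : ℝ}

theorem edist_le_rpow_mul [hp : Fact (1 < p)] {X : Type*} [PseudoMetricSpace X] {ρ : ℝ → X}
    {g : ℝ → ℝ≥0∞} (hg : Measurable g)
    (hb : ∀ a b, a ≤ b → edist (ρ a) (ρ b) ≤ ∫⁻ u in Ioc a b, g u) {C : ℝ≥0∞}
    (hC : ∫⁻ u, g u ^ p ≤ C) (a b : ℝ) :
    edist (ρ a) (ρ b) ≤ C ^ (1 / p) * ENNReal.ofReal |b - a| ^ (1 - 1 / p) := by
  have hp0 : 0 < p := zero_lt_one.trans hp.out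
  refine (edist_le_setLIntegral_uIoc hb a b).trans
    ((setLIntegral_le_rpow_mul_volume_rpow hp.out hg _).trans ?_)
  rw [Real.volume_uIoc]
  refine mul_le_mul' (ENNReal.rpow_le_rpow ?_ (by positivity)) le_rfl
  exact (setLIntegral_le_lintegral _ _).trans hC

/-- The Wasserstein metric is uniformly stronger than the Lévy–Prokhorov metric. -/
theorem dist_toLP_le [hp : Fact (1 < p)] {μ ν : ProbWithMoment d p} {ε : ℝ} (hε : 0 < ε)
    (h : edist μ ν < ENNReal.ofReal ε * ENNReal.ofReal ε ^ (1 / p)) :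
    dist (toLP μ) (toLP ν) ≤ ε := by
  have h1 := levyProkhorovEDist_le_of_wassersteinEDist_lt (zero_lt_one.trans hp.out)
    μ.meas ν.meas hε h
  exact ENNReal.toReal_le_of_le_ofReal hε.le h1

/-- The `δ` depends on `C` and `ε` but not on the path, which gives equicontinuity of the whole
sequence. -/
theorem exists_modulus_toLP [hp : Fact (1 < p)] {C : ℝ≥0∞} (hC : C ≠ ∞) {ε : ℝ} (hε : 0 < ε) :
    ∃ δ > 0, ∀ (ρ : ℝ → ProbWithMoment d p),
      (∀ a b, edist (ρ a) (ρ b) ≤ C * ENNReal.ofReal |b - a| ^ (1 - 1 / p)) →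
      ∀ a b, |b - a| < δ → dist (toLP (ρ a)) (toLP (ρ b)) < ε := by
  have hp0 : 0 < p := zero_lt_one.trans hp.out
  have hr : 0 < 1 - 1 / p := by rw [sub_pos, div_lt_one hp0]; exact hp.out
  have hlim : Tendsto (fun x : ℝ => C * ENNReal.ofReal x ^ (1 - 1 / p)) (𝓝 0) (𝓝 0) := by
    have h1 : Tendsto (fun x : ℝ => ENNReal.ofReal x ^ (1 - 1 / p)) (𝓝 0)
        (𝓝 (ENNReal.ofReal 0 ^ (1 - 1 / p))) :=
      ((ENNReal.continuous_rpow_const.comp ENNReal.continuous_ofReal).tendsto 0)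
    rw [ENNReal.ofReal_zero, ENNReal.zero_rpow_of_pos hr] at h1
    simpa using ENNReal.Tendsto.const_mul (a := C) h1 (Or.inr hC)
  have hpos : 0 < ENNReal.ofReal (ε / 2) * ENNReal.ofReal (ε / 2) ^ (1 / p) :=
    ENNReal.mul_pos (by simpa using hε) (by simp [hε, hp0])
  obtain ⟨δ, hδ, hball⟩ := Metric.eventually_nhds_iff.1 (hlim.eventually_lt_const hpos)
  refine ⟨δ, hδ, fun ρ hρ a b hab => ?_⟩
  refine (dist_toLP_le (half_pos hε) ((hρ a b).trans_lt (hball ?_))).trans_lt (half_lt_self hε)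
  simpa using hab

/-- Paths with a common modulus of continuity in the Wasserstein metric and a common endpoint have
a subsequence that converges uniformly in the Lévy–Prokhorov metric. -/
theorem exists_subseq_tendstoUniformlyOn [hp : Fact (1 < p)] {t : ℝ} (ht : 0 ≤ t) {C : ℝ≥0∞}
    (hC : C ≠ ∞) {σ : ℕ → ℝ → ProbWithMoment d p} {μ : ProbWithMoment d p}
    (hend : ∀ k, σ k t = μ)
    (hmod : ∀ k a b, edist (clampPath t (σ k) a) (clampPath t (σ k) b) ≤
      C * ENNReal.ofReal |b - a| ^ (1 - 1 / p)) :
    ∃ (φ : ℕ → ℕ) (η : ℝ → ProbWithMoment d p) (R : ℝ≥0∞), StrictMono φ ∧ R ≠ ∞ ∧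
      (∀ k, ∀ s ∈ Icc 0 t, ∫⁻ x, ‖x‖ₑ ^ p ∂(σ k s).meas ≤ R) ∧
      ConvergesNarrowlyUniformly t (fun j => σ (φ j)) η := by
  have hp0 : 0 < p := zero_lt_one.trans hp.out
  have hr : 0 ≤ 1 - 1 / p := by rw [sub_nonneg, div_le_one hp0]; exact hp.out.le
  -- Distance to the common endpoint `μ` plus the `p`-th root of its moment, all to the power `p`.
  set R : ℝ≥0∞ :=
    (C * ENNReal.ofReal t ^ (1 - 1 / p) + (∫⁻ x, ‖x‖ₑ ^ p ∂μ.meas) ^ (1 / p)) ^ p with hR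
  have hRt : R ≠ ∞ := by
    refine ENNReal.rpow_ne_top_of_nonneg hp0.le (ENNReal.add_ne_top.2 ⟨ENNReal.mul_ne_top hC
      (ENNReal.rpow_ne_top_of_nonneg hr ENNReal.ofReal_ne_top),
      ENNReal.rpow_ne_top_of_nonneg (by positivity) μ.2.ne⟩)
  have hmom : ∀ k, ∀ s ∈ Icc 0 t, ∫⁻ x, ‖x‖ₑ ^ p ∂(σ k s).meas ≤ R := by
    intro k s hs
    have h1 := moment_rpow_le hp.out.le (σ k s).meas μ.meas
    have h2 := hmod k s t
    simp only [clampPath, clamp_of_mem hs, clamp_of_mem (right_mem_Icc.2 ht), hend] at h2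
    have h3 : |t - s| ≤ t := by rw [abs_of_nonneg (by linarith [hs.2])]; linarith [hs.1]
    have h4 : wassersteinEDist p (σ k s).meas μ.meas ≤ C * ENNReal.ofReal t ^ (1 - 1 / p) :=
      h2.trans (mul_le_mul' le_rfl (ENNReal.rpow_le_rpow (ENNReal.ofReal_le_ofReal h3) hr))
    have h5 := ENNReal.rpow_le_rpow (h1.trans (add_le_add h4 le_rfl)) hp0.le
    rwa [← ENNReal.rpow_mul, one_div_mul_cancel hp0.ne', ENNReal.rpow_one] at h5
  have hequi : ∀ ε > 0, ∃ δ > 0, ∀ a b : Icc 0 t, dist a b < δ → ∀ k,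
      dist (toLP (σ k a)) (toLP (σ k b)) < ε := by
    intro ε hε
    obtain ⟨δ, hδ, h⟩ := exists_modulus_toLP (d := d) (p := p) hC hε
    refine ⟨δ, hδ, fun a b hab k => ?_⟩
    have h1 := h _ (hmod k) a b (by rwa [Subtype.dist_eq, dist_comm, Real.dist_eq] at hab)
    simpa only [clampPath, clamp_of_mem a.2, clamp_of_mem b.2] using h1
  have hcont : ∀ k, Continuous fun s : Icc 0 t => toLP (σ k s) := by
    intro k
    refine Metric.continuous_iff.2 fun b ε hε => ?_
    obtain ⟨δ, hδ, h⟩ := hequi ε hε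
    exact ⟨δ, hδ, fun a hab => h a b hab k⟩
  let F : ℕ → BoundedContinuousFunction (Icc 0 t) (LevyProkhorov (ProbabilityMeasure (Space d))) :=
    fun k => BoundedContinuousFunction.mkOfCompact ⟨fun s : Icc 0 t => toLP (σ k s), hcont k⟩
  set K : Set (LevyProkhorov (ProbabilityMeasure (Space d))) :=
    LevyProkhorov.ofMeasure '' {ν : ProbabilityMeasure (Space d) |
      ∫⁻ x, ‖x‖ₑ ^ p ∂(ν : Measure (Space d)) ≤ R} with hK
  have hKc : IsCompact K := (isCompact_setOf_moment_le hp0 hRt).image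
    LevyProkhorov.continuous_ofMeasure_probabilityMeasure
  have hA : IsCompact (closure (range F)) := by
    refine BoundedContinuousFunction.arzela_ascoli K hKc _ ?_ ?_
    · rintro _ s ⟨k, rfl⟩
      exact ⟨(σ k s).1, hmom k s s.2, rfl⟩
    · refine UniformEquicontinuous.equicontinuous (Metric.uniformEquicontinuous_iff.2 ?_)
      intro ε hε
      obtain ⟨δ, hδ, h⟩ := hequi ε hε
      refine ⟨δ, hδ, ?_⟩
      rintro a b hab ⟨_, k, rfl⟩
      exact h a b hab k
  obtain ⟨G, -, φ, hφ, hG⟩ := hA.tendsto_subseq fun k => subset_closure (mem_range_self k)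
  have hunif := BoundedContinuousFunction.tendsto_iff_tendstoUniformly.1 hG
  -- Arzelà–Ascoli yields a path of probability measures only; closedness of `K` provides the finite
  -- moments.
  have hGmom : ∀ s : Icc 0 t,
      ∫⁻ x, ‖x‖ₑ ^ p ∂((G s).toMeasure : Measure (Space d)) ≤ R := by
    intro s
    have h1 : G s ∈ K := hKc.isClosed.mem_of_tendsto (hunif.tendsto_at s)
      (Eventually.of_forall fun k => ⟨(σ (φ k) s).1, hmom _ s s.2, rfl⟩)
    obtain ⟨ν, hν, hνs⟩ := h1
    rw [← hνs]; exact hν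
  let η : ℝ → ProbWithMoment d p := fun s =>
    ⟨(G ⟨clamp t s, clamp_mem ht s⟩).toMeasure, (hGmom _).trans_lt (lt_top_iff_ne_top.2 hRt)⟩
  have hη : (Icc 0 t).domRestrict (fun s => toLP (η s)) = G := by
    funext s
    have : (⟨clamp t s, clamp_mem ht s⟩ : Icc 0 t) = s := Subtype.ext (clamp_of_mem s.2)
    change LevyProkhorov.ofMeasure (G ⟨clamp t s, clamp_mem ht s⟩).toMeasure = G s
    rw [this]
  refine ⟨φ, η, R, hφ, hRt, hmom, fun j => ?_, ?_, ?_⟩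
  · exact continuousOn_iff_continuous_domRestrict.2 (hcont (φ j))
  · rw [continuousOn_iff_continuous_domRestrict, hη]; exact G.continuous
  · rw [tendstoUniformlyOn_iff_tendstoUniformly_comp_coe]
    change TendstoUniformly _ ((Icc 0 t).domRestrict fun s => toLP (η s)) atTop
    rw [hη]
    exact hunif

theorem tendsto_of_convergesNarrowlyUniformly {t : ℝ} {σ : ℕ → ℝ → ProbWithMoment d p}
    {η : ℝ → ProbWithMoment d p} (h : ConvergesNarrowlyUniformly t σ η) {s : ℝ}
    (hs : s ∈ Icc 0 t) : Tendsto (fun j => (σ j s).1) atTop (𝓝 (η s).1) :=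
  (LevyProkhorov.continuous_toMeasure_probabilityMeasure.tendsto _).comp (h.2.2.tendsto_at hs)

/-- The action is lower semicontinuous for narrow convergence, and its finiteness is inherited. -/
theorem mem_ACp_and_pAction_le_of_tendsto [hp : Fact (1 < p)] {t : ℝ} (ht : 0 ≤ t)
    {σ : ℕ → ℝ → ProbWithMoment d p} {η : ℝ → ProbWithMoment d p} (hσ : ∀ k, σ k ∈ ACp d p t)
    {R : ℝ≥0∞} (hR : R ≠ ∞) (hmom : ∀ k, ∀ s ∈ Icc 0 t, ∫⁻ x, ‖x‖ₑ ^ p ∂(σ k s).meas ≤ R)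
    (hlim : ∀ s ∈ Icc 0 t, Tendsto (fun j => (σ j s).1) atTop (𝓝 (η s).1)) {L : ℝ}
    (hL : Tendsto (fun k => pAction t (σ k)) atTop (𝓝 L)) :
    η ∈ ACp d p t ∧ IsMetricDerivative t η (metricDerivative t η) ∧ pAction t η ≤ L := by
  have hp0 : 0 < p := zero_lt_one.trans hp.out
  have hL0 : 0 ≤ L := ge_of_tendsto' hL fun k => pAction_nonneg ht (hσ k)
  obtain ⟨M, hM⟩ := hL.bddAbove_range
  -- Extending the metric derivative itself, not an arbitrary speed bound, makes `∫ g_k ^ p` equal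
  -- to the action.
  choose g hgm _ hgb hgf hgp using fun k =>
    (isMetricDerivative_of_mem_ACp ht (hσ k)).1.exists_extension ht
  change ∀ k, ∫⁻ u, g k u ^ p = ENNReal.ofReal (pAction t (σ k)) at hgp
  have hgC : ∀ k, ∫⁻ u, g k u ^ p ≤ ENNReal.ofReal M := fun k => by
    rw [hgp]; exact ENNReal.ofReal_le_ofReal (hM (mem_range_self k))
  have hlsc : ∀ a b, edist (clampPath t η a) (clampPath t η b) ≤
      liminf (fun k => edist (clampPath t (σ k) a) (clampPath t (σ k) b)) atTop := fun a b =>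
    wassersteinEDist_le_liminf hp0 hR (hlim _ (clamp_mem ht a)) (hlim _ (clamp_mem ht b))
      (fun k => hmom k _ (clamp_mem ht a)) fun k => hmom k _ (clamp_mem ht b)
  have hac := absolutelyContinuousOnInterval_of_liminf hp.out hgm hgb ENNReal.ofReal_ne_top hgC hlsc
  -- The limit criterion is applied to a constant sequence.
  have hcont : ∀ k, Continuous (clampPath t (σ k)) := fun k =>
    continuous_of_absolutelyContinuousOnInterval (absolutelyContinuousOnInterval_of_liminf
      (ρ := fun _ => clampPath t (σ k)) (g := fun _ => g k) hp.out (fun _ => hgm k)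
      (fun _ => hgb k) ENNReal.ofReal_ne_top (fun _ => hgC k) fun a b => by simp)
  have hact := lintegral_lowerSpeed_rpow_le_liminf hp.out hgm hgb hcont
    (continuous_of_absolutelyContinuousOnInterval hac) hlsc
  simp only [hgp] at hact
  rw [(ENNReal.tendsto_ofReal hL).liminf_eq] at hact
  have hfin := ne_top_of_le_ne_top ENNReal.ofReal_ne_top hact
  have hmd := isMetricDerivative_lowerSpeed ht hac hfin
  refine ⟨⟨_, hmd.1⟩, isMetricDerivative_metricDerivative hmd, ?_⟩
  rw [pAction_eq_toReal_lintegral ht hac hfin]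
  exact ENNReal.toReal_le_of_le_ofReal hL0 ((setLIntegral_le_lintegral _ _).trans hact)

end Compactness

end WassersteinCurves

end

theorem proposition4p1 (d : ℕ) (p : ℝ) (hp : 1 < p) (t : ℝ) (ht : 0 ≤ t)
    (μ : WassersteinCurves.ProbWithMoment d p)
    (σ : ℕ → ℝ → WassersteinCurves.ProbWithMoment d p)
    (hσ : ∀ k, σ k ∈ WassersteinCurves.ACp d p t)
    (hend : ∀ k, σ k t = μ)
    (hbound : BddAbove (Set.range fun k => WassersteinCurves.pAction t (σ k))) :
    ∃ (φ : ℕ → ℕ) (η : ℝ → WassersteinCurves.ProbWithMoment d p),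
      StrictMono φ ∧
      η ∈ WassersteinCurves.ACp d p t ∧
      WassersteinCurves.IsMetricDerivative t η (WassersteinCurves.metricDerivative t η) ∧
      WassersteinCurves.ConvergesNarrowlyUniformly t (fun j => σ (φ j)) η ∧
      WassersteinCurves.pAction t η ≤
        Filter.liminf (fun j => WassersteinCurves.pAction t (σ (φ j))) Filter.atTop := by
  have hpf : Fact (1 < p) := ⟨hp⟩
  obtain ⟨M, hM⟩ := hbound
  have hIcc : ∀ k, WassersteinCurves.pAction t (σ k) ∈ Icc 0 M := fun k =>
    ⟨WassersteinCurves.pAction_nonneg ht (hσ k), hM (mem_range_self k)⟩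
  -- The actions are made convergent first, so that along any further subsequence their liminf is
  -- still `L`.
  obtain ⟨L, -, φ, hφ, hL⟩ := isCompact_Icc.tendsto_subseq hIcc
  have hmod : ∀ k a b, edist (WassersteinCurves.clampPath t (σ k) a)
      (WassersteinCurves.clampPath t (σ k) b) ≤
      ENNReal.ofReal M ^ (1 / p) * ENNReal.ofReal |b - a| ^ (1 - 1 / p) := by
    intro k
    obtain ⟨g, hgm, -, hgb, -, hgp⟩ :=
      (WassersteinCurves.isMetricDerivative_of_mem_ACp ht (hσ k)).1.exists_extension ht
    exact WassersteinCurves.edist_le_rpow_mul hgm hgb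
      (hgp.trans_le (ENNReal.ofReal_le_ofReal (hIcc k).2))
  obtain ⟨ψ, η, R, hψ, hR, hmom, hconv⟩ := WassersteinCurves.exists_subseq_tendstoUniformlyOn ht
    (ENNReal.rpow_ne_top_of_nonneg (by positivity) ENNReal.ofReal_ne_top)
    (fun k => hend (φ k)) (fun k => hmod (φ k))
  have hL' := hL.comp hψ.tendsto_atTop
  obtain ⟨h1, h2, h3⟩ := WassersteinCurves.mem_ACp_and_pAction_le_of_tendsto ht
    (fun k => hσ (φ (ψ k))) hR (fun k => hmom (ψ k))
    (fun s hs => WassersteinCurves.tendsto_of_convergesNarrowlyUniformly hconv hs) hL'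
  exact ⟨φ ∘ ψ, η, hφ.comp hψ, h1, h2, hconv, h3.trans_eq hL'.liminf_eq.symm⟩
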